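/- Let $s\ge 1$ be an integer, $M>0$, $\mathcal X\subseteq\mathbb R$ measurable, $x_0\in\mathcal X$, and let $f_0$ be a probability density on $\mathcal X$ (with respect to Lebesgue measure, extended by $0$ outside $\mathcal X$) that is $s$ times continuously differentiable at $x_0$ (i.e. $C^s$ in a neighbourhood of $x_0$). For $\delta,\varepsilon>0$ let $U(\delta;\varepsilon)$ be the set of all densities $f$ on $\mathcal X$ that are $s$ times differentiable at $x_0$ with $$|f^{(s)}(x_0)|\le (1+M)\,|f_0^{(s)}(x_0)|$$ and that satisfy, for all $k\in\{0,1,\dots,s\}$, $$\int_{|x-x_0|\le\varepsilon}|f^{(k)}(x)-f_0^{(k)}(x)|\,dx\le\delta .$$ (Here, wherever $f_0$ is $k$ times differentiable on $|x-x_0|\le\varepsilon$, $f$ is required to be so too, and the integral runs over these points.) Call $K:\mathbb R\to\mathbb R$ a kernel if it is bounded, $s$ times differentiable with bounded $s$-th derivative, integrable with $\int K=1$, and $\int_{-1}^1u^kK(u)\,du=0$ for all integers $0<k<s$, with $\int_{-1}^1u^sK(u)\,du$ finite. Put $$C(s,M,K)=\frac{(8s)^{\frac{2s}{2s+1}}}{4+8s}\,\pi^{-\frac{2}{2s+1}}\Big(\frac{|K^{(s)}(0)|}{M}\Big)^{\frac{4s}{2s+1}}\Big(\int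 K^2\Big)^{-\frac{2s}{2s+1}}\left[\frac{M\int K^2}{|K^{(s)}(0)|}-\sqrt{\pi^2(4+8s)}\,\left|\int_{-1}^1\frac{K(u)|u|^s}{(s-1)!}\,du\,\Big(1+\frac{M\int_{-1}^1|K^{(s)}(u)|\,du}{|K^{(s)}(0)|}\Big)\right|\right]_+^2$$ if $K^{(s)}(0)\ne0$, and $C(s,M,K)=0$ if $K^{(s)}(0)=0$. This depends only on $s$, $M$ and $K$. Let $c_0>0$, $0\le r<\frac1{2s+1}$ and $\delta_n=c_0n^{-r}$. Then for every $\varepsilon>0$, $$\liminf_{n\to\infty}\ \inf_T\ \sup_{f\in U(\delta_n;\varepsilon)}n^{\frac{2s}{2s+1}}\,\mathbb E_f\big|T(X_1,\dots,X_n)-f(x_0)\big|^2\ \ge\ \sup_K\ C(s,M,K)\,f_0(x_0)^{\frac{2s}{2s+1}}\,|f_0^{(s)}(x_0)|^{\frac{2}{2s+1}},$$ where $X_1,\dots,X_n$ are i.i.d. with density $f$ under $\mathbb E_f$, the infimum is over all measurable $T$ of $n$ observations, the supremum on the right is over all kernels $K$, and both sides take values in $[0,\infty]$. -/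

import Mathlib

open MeasureTheory Filter Topology
open scoped ENNReal

namespace DensityLAM

/-- `f` is a probability density, with respect to Lebesgue measure, on the sample space
`S ⊆ ℝ` (extended by zero outside `S`). -/
structure IsDensityOn (S : Set ℝ) (f : ℝ → ℝ) : Prop where
  measurable : Measurable f
  nonneg : ∀ x, 0 ≤ f x
  support : ∀ x, x ∉ S → f x = 0
  total : ∫⁻ x, ENNReal.ofReal (f x) = 1

/-- `f` is `k` times differentiable at the point `x`: the derivatives of order less than `k`
exist near `x`, and the one of order `k - 1` is differentiable at `x`. -/
def DiffTimesAt (k : ℕ) (f : ℝ → ℝ) (x : ℝ) : Prop :=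
  (∀ j, j + 1 < k → ∀ᶠ y in 𝓝 x, DifferentiableAt ℝ (iteratedDeriv j f) y) ∧
    ∀ j < k, DifferentiableAt ℝ (iteratedDeriv j f) x

/-- The class `F(s, f₀, x₀, M)` of densities. -/
def smoothClass (S : Set ℝ) (s : ℕ) (f₀ : ℝ → ℝ) (x₀ M : ℝ) : Set (ℝ → ℝ) :=
  {f | IsDensityOn S f ∧ DiffTimesAt s f x₀ ∧
    |iteratedDeriv s f x₀| ≤ (1 + M) * |iteratedDeriv s f₀ x₀|}

/-- The localized class `U(δ; ε)`. The comparison of the `k`-th derivatives presupposes that they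
exist: wherever `f₀` is `k` times differentiable in `|x - x₀| ≤ ε`, so must `f` be, and the
integral runs over these points (all of `|x - x₀| ≤ ε` if `f₀` is `s` times differentiable
there; always a neighbourhood of `x₀` if `f₀` is `C^s` at `x₀`). -/
def localClass (S : Set ℝ) (s : ℕ) (f₀ : ℝ → ℝ) (x₀ M δ ε : ℝ) : Set (ℝ → ℝ) :=
  {f | f ∈ smoothClass S s f₀ x₀ M ∧ ∀ k ≤ s,
    (∀ x, |x - x₀| ≤ ε → DiffTimesAt k f₀ x → DiffTimesAt k f x) ∧
    ∫⁻ x in {x | |x - x₀| ≤ ε ∧ DiffTimesAt k f₀ x},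
      ENNReal.ofReal |iteratedDeriv k f x - iteratedDeriv k f₀ x| ≤ ENNReal.ofReal δ}

/-- The joint law of `n` i.i.d. observations with density `f`. -/
noncomputable def sampleLaw (n : ℕ) (f : ℝ → ℝ) : Measure (Fin n → ℝ) :=
  Measure.pi fun _ => volume.withDensity fun y => ENNReal.ofReal (f y)

/-- The squared risk `E_f |T(X₁, …, Xₙ) - f(x₀)|²`, possibly infinite. -/
noncomputable def risk (n : ℕ) (f : ℝ → ℝ) (x₀ : ℝ) (T : (Fin n → ℝ) → ℝ) : ℝ≥0∞ :=
  ∫⁻ X, ENNReal.ofReal (|T X - f x₀| ^ 2) ∂(sampleLaw n f)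

/-- The minimax risk over the class `U`, scaled by `n ^ (2s / (2s + 1))`; the infimum is over
all measurable functions `T` of the `n` observations. -/
noncomputable def scaledMinimaxRisk (s n : ℕ) (x₀ : ℝ) (U : Set (ℝ → ℝ)) : ℝ≥0∞ :=
  ⨅ (T : (Fin n → ℝ) → ℝ) (_ : Measurable T), ⨆ f ∈ U,
    ENNReal.ofReal ((n : ℝ) ^ (2 * s / (2 * s + 1) : ℝ)) * risk n f x₀ T

/-- The conditions on the kernel `K`. -/
structure IsKernel (s : ℕ) (K : ℝ → ℝ) : Prop where
  bounded : ∃ B, ∀ u, |K u| ≤ B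
  differentiable : ∀ j < s, Differentiable ℝ (iteratedDeriv j K)
  bounded_deriv : ∃ B, ∀ u, |iteratedDeriv s K u| ≤ B
  integrable : Integrable K
  integral_eq_one : ∫ u, K u = 1
  moment_eq_zero : ∀ k, 0 < k → k < s → ∫ u in (-1 : ℝ)..1, u ^ k * K u = 0
  moment_finite : IntervalIntegrable (fun u => u ^ s * K u) volume (-1) 1

/-- The constant `C(s, M, K)`. It divides by `|K⁽ˢ⁾(0)|` and is given the (trivial) value `0` when
`K⁽ˢ⁾(0) = 0`. -/
noncomputable def lamConst (s : ℕ) (M : ℝ) (K : ℝ → ℝ) : ℝ :=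
  (8 * s : ℝ) ^ (2 * s / (2 * s + 1) : ℝ) / (4 + 8 * s)
    * Real.pi ^ (-(2 / (2 * s + 1)) : ℝ)
    * (|iteratedDeriv s K 0| / M) ^ (4 * s / (2 * s + 1) : ℝ)
    * (∫ u, K u ^ 2) ^ (-(2 * s / (2 * s + 1)) : ℝ)
    * (max 0 (M * (∫ u, K u ^ 2) / |iteratedDeriv s K 0|
        - Real.sqrt (Real.pi ^ 2 * (4 + 8 * s))
          * |(∫ u in (-1 : ℝ)..1, K u * |u| ^ s / (Nat.factorial (s - 1) : ℝ))
              * (1 + M * (∫ u in (-1 : ℝ)..1, |iteratedDeriv s K u|)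
                  / |iteratedDeriv s K 0|)|)) ^ 2

end DensityLAM

namespace DensityLAM

open scoped ContDiff

/-! If `f₀ x₀ = 0` the right-hand side vanishes. Otherwise the left-hand side is infinite, so the
exact constant plays no role. The class bounds the `s`-th derivative only at the single point `x₀`,
and controls nearby derivatives only in `L¹`. A tall narrow bump that is flat at `x₀` leaves the
derivatives of positive order at `x₀` unchanged.

Add to `f₀` a zero-mean bump of height `a` and width `h`. Up to constants, its derivatives of order
at most `s` have `L¹` norm at most `a * h ^ (1 - s)`, and its `χ²` cost over `n` observations is `n
* h * a ^ 2`. With `h = n ^ (-β)` and `n * h * a ^ 2 = 1` the two laws remain confusable, and Le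
Cam's two-point bound (`two_point_bound`, `two_point_risk_bound`) gives risk of order `a ^ 2 = n ^
(β - 1)`. Since `r < 1 / (2s + 1)`, some `β > 1 / (2s + 1)` still keeps the bump inside the class
(`add_bump_mem_localClass`), and the scaled risk then grows like `n ^ (β - 1 / (2s + 1))`. -/

/-! ### Product measures and Le Cam's two-point bound. -/

theorem lintegral_pi_prod {n : ℕ} (μ : Measure ℝ) [IsProbabilityMeasure μ]
    (u : Fin n → ℝ → ℝ≥0∞) (hu : ∀ i, Measurable (u i)) :
    ∫⁻ X, ∏ i, u i (X i) ∂(Measure.pi fun _ : Fin n => μ) = ∏ i, ∫⁻ x, u i x ∂μ := by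
  have hind := ProbabilityTheory.iIndepFun_pi (μ := fun _ : Fin n => μ) (X := u)
    (fun i => (hu i).aemeasurable)
  have h := ProbabilityTheory.lintegral_prod_eq_prod_lintegral_of_indepFun Finset.univ
    (fun i (X : Fin n → ℝ) => u i (X i)) hind (fun i => (hu i).comp (measurable_pi_apply i))
  refine h.trans (Finset.prod_congr rfl fun i _ => ?_)
  exact (measurePreserving_eval (fun _ : Fin n => μ) i).lintegral_comp (hu i)

theorem pi_withDensity_prod (n : ℕ) (μ : Measure ℝ) [IsProbabilityMeasure μ]
    (l : ℝ → ℝ≥0∞) (hl : Measurable l) [SigmaFinite (μ.withDensity l)] :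
    (Measure.pi fun _ : Fin n => μ.withDensity l)
      = (Measure.pi fun _ : Fin n => μ).withDensity fun X => ∏ i, l (X i) := by
  refine Measure.pi_eq fun t ht => ?_
  rw [withDensity_apply _ (MeasurableSet.univ_pi ht),
    ← lintegral_indicator (MeasurableSet.univ_pi ht)]
  have h : (Set.univ.pi t).indicator (fun X : Fin n → ℝ => ∏ i, l (X i))
      = fun X => ∏ i, (t i).indicator l (X i) := by
    funext X
    by_cases hX : X ∈ Set.univ.pi t
    · rw [Set.indicator_of_mem hX]
      exact Finset.prod_congr rfl fun i _ =>
        (Set.indicator_of_mem (hX i (Set.mem_univ i)) _).symm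
    · rw [Set.indicator_of_notMem hX]
      obtain ⟨i, hi⟩ : ∃ i, X i ∉ t i := by simpa [Set.mem_pi] using hX
      exact (Finset.prod_eq_zero (Finset.mem_univ i) (Set.indicator_of_notMem hi _)).symm
  rw [h, lintegral_pi_prod μ _ fun i => hl.indicator (ht i)]
  exact Finset.prod_congr rfl fun i _ => by
    rw [lintegral_indicator (ht i), withDensity_apply _ (ht i)]

/-- Le Cam's two-point bound, with the second law absolutely continuous with respect to the
first and the second moment of the likelihood ratio bounded by `χ`. -/
theorem two_point_bound {Ω : Type*} [MeasurableSpace Ω] (P : Measure Ω)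
    (L : Ω → ℝ) (hL : Measurable L) (hL0 : ∀ z, 0 ≤ L z)
    (hL1 : ∫⁻ z, ENNReal.ofReal (L z) ∂P = 1) (χ : ℝ) (hχ : 0 < χ)
    (hL2 : ∫⁻ z, ENNReal.ofReal (L z ^ 2) ∂P ≤ ENNReal.ofReal χ)
    (T : Ω → ℝ) (hT : Measurable T) (a b : ℝ) :
    ENNReal.ofReal (|a - b| ^ 2 / 2) ≤
      ENNReal.ofReal χ * ∫⁻ z, ENNReal.ofReal (|T z - a| ^ 2) ∂P
        + ∫⁻ z, ENNReal.ofReal (|T z - b| ^ 2)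
            ∂(P.withDensity fun z => ENNReal.ofReal (L z)) := by
  set D := |a - b| ^ 2 with hD
  have hD0 : 0 ≤ D := by positivity
  -- Triangle inequality, then AM-GM on each cross term. The weights are chosen so that each
  -- remainder integrates to at most `D / 4`, leaving `D / 2` for the risks.
  have hpt : ∀ z, ENNReal.ofReal D * ENNReal.ofReal (L z)
      ≤ (ENNReal.ofReal χ * ENNReal.ofReal (|T z - a| ^ 2)
        + ENNReal.ofReal (L z) * ENNReal.ofReal (|T z - b| ^ 2))
        + (ENNReal.ofReal (D / (4 * χ)) * ENNReal.ofReal (L z ^ 2)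
          + ENNReal.ofReal (D / 4) * ENNReal.ofReal (L z)) := by
    intro z
    have hl := hL0 z
    rw [← ENNReal.ofReal_mul hD0, ← ENNReal.ofReal_mul hχ.le, ← ENNReal.ofReal_mul hl,
      ← ENNReal.ofReal_mul (by positivity), ← ENNReal.ofReal_mul (by positivity),
      ← ENNReal.ofReal_add (by positivity) (by positivity),
      ← ENNReal.ofReal_add (by positivity) (by positivity),
      ← ENNReal.ofReal_add (by positivity) (by positivity)]
    refine ENNReal.ofReal_le_ofReal ?_
    set p := |T z - a|
    set q := |T z - b|
    set d := |a - b|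
    have htri : d ≤ p + q := by
      have := abs_sub_le a (T z) b
      rwa [abs_sub_comm a (T z)] at this
    have hd : 0 ≤ d := abs_nonneg _
    have e1 : d * p * L z ≤ χ * p ^ 2 + D / (4 * χ) * L z ^ 2 := by
      have h0 : 0 ≤ (2 * χ * p - d * L z) ^ 2 / (4 * χ) := by positivity
      have h1 : (2 * χ * p - d * L z) ^ 2 / (4 * χ)
          = χ * p ^ 2 + D / (4 * χ) * L z ^ 2 - d * p * L z := by
        rw [hD]; field_simp; ring
      linarith
    have e2 : d * q * L z ≤ L z * q ^ 2 + D / 4 * L z := by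
      have h0 : 0 ≤ L z * (q - d / 2) ^ 2 := by positivity
      have h1 : L z * (q - d / 2) ^ 2 = L z * q ^ 2 + D / 4 * L z - d * q * L z := by
        rw [hD]; ring
      linarith
    have e3 : D * L z ≤ d * p * L z + d * q * L z := by
      have : D * L z = d * d * L z := by rw [hD]; ring
      have h2 : d * d * L z ≤ d * (p + q) * L z := by gcongr
      linarith
    linarith
  have hmL : Measurable fun z => ENNReal.ofReal (L z) := hL.ennreal_ofReal
  have hma : Measurable fun z => ENNReal.ofReal (|T z - a| ^ 2) :=
    ((hT.sub_const a).abs.pow_const 2).ennreal_ofReal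
  have hmb : Measurable fun z => ENNReal.ofReal (|T z - b| ^ 2) :=
    ((hT.sub_const b).abs.pow_const 2).ennreal_ofReal
  have hm2 : Measurable fun z => ENNReal.ofReal (L z ^ 2) := (hL.pow_const 2).ennreal_ofReal
  have hint := lintegral_mono (μ := P) hpt
  rw [lintegral_const_mul _ hmL, hL1, mul_one,
    lintegral_add_left (by fun_prop),
    lintegral_add_left (hma.const_mul _), lintegral_const_mul _ hma,
    lintegral_add_left (hm2.const_mul _), lintegral_const_mul _ hm2, lintegral_const_mul _ hmL,
    hL1, mul_one] at hint
  rw [lintegral_withDensity_eq_lintegral_mul _ hmL hmb]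
  have hrest : ENNReal.ofReal (D / (4 * χ)) * ∫⁻ z, ENNReal.ofReal (L z ^ 2) ∂P
      + ENNReal.ofReal (D / 4) ≤ ENNReal.ofReal (D / 2) := by
    calc _ ≤ ENNReal.ofReal (D / (4 * χ)) * ENNReal.ofReal χ + ENNReal.ofReal (D / 4) := by
          gcongr
      _ = ENNReal.ofReal (D / 2) := by
          rw [← ENNReal.ofReal_mul (by positivity),
            ← ENNReal.ofReal_add (by positivity) (by positivity)]
          congr 1; field_simp; ring
  have hsplit : ENNReal.ofReal D = ENNReal.ofReal (D / 2) + ENNReal.ofReal (D / 2) := by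
    rw [← ENNReal.ofReal_add (by positivity) (by positivity)]; congr 1; ring
  rw [hsplit] at hint
  exact (ENNReal.add_le_add_iff_right ENNReal.ofReal_ne_top).1
    (hint.trans (add_le_add_right hrest _))

/-! ### Calculus of pointwise `k`-fold differentiability. -/

/-- Additivity holds on a neighbourhood only below the top order, since `f` may fail to be `k` times
differentiable off `x`. Order `k` follows at the point `x` alone, by differentiating the identity
for order `k - 1`. -/
theorem DiffTimesAt.eventually_iteratedDeriv_add {k : ℕ} {f g : ℝ → ℝ} {x : ℝ}
    (hf : DiffTimesAt k f x) (hg : ContDiff ℝ ∞ g) {j : ℕ} (hj : j < k) :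
    iteratedDeriv j (f + g) =ᶠ[𝓝 x] iteratedDeriv j f + iteratedDeriv j g := by
  induction j with
  | zero => simp [iteratedDeriv_zero]
  | succ j ih =>
    filter_upwards [(ih (by omega)).eventuallyEq_nhds, hf.1 j hj] with y hy hfy
    simp only [iteratedDeriv_succ, Pi.add_apply]
    rw [hy.deriv_eq]
    exact deriv_add hfy (hg.differentiable_iteratedDeriv j (by exact_mod_cast WithTop.coe_lt_top _) y)

theorem DiffTimesAt.add {k : ℕ} {f g : ℝ → ℝ} {x : ℝ}
    (hf : DiffTimesAt k f x) (hg : ContDiff ℝ ∞ g) : DiffTimesAt k (f + g) x := by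
  have hgd := fun j => hg.differentiable_iteratedDeriv j (by exact_mod_cast WithTop.coe_lt_top _)
  refine ⟨fun j hj => ?_, fun j hj => ?_⟩
  · filter_upwards [(hf.eventually_iteratedDeriv_add hg (by omega : j < k)).eventuallyEq_nhds,
      hf.1 j hj] with y hy hfy
    exact (hfy.add (hgd j y)).congr_of_eventuallyEq hy
  · exact ((hf.2 j hj).add (hgd j x)).congr_of_eventuallyEq
      (hf.eventually_iteratedDeriv_add hg hj)

theorem DiffTimesAt.iteratedDeriv_add {k : ℕ} {f g : ℝ → ℝ} {x : ℝ}
    (hf : DiffTimesAt k f x) (hg : ContDiff ℝ ∞ g) :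
    iteratedDeriv k (f + g) x = iteratedDeriv k f x + iteratedDeriv k g x := by
  cases k with
  | zero => simp [iteratedDeriv_zero]
  | succ k =>
    simp only [iteratedDeriv_succ]
    rw [(hf.eventually_iteratedDeriv_add hg k.lt_succ_self).deriv_eq]
    exact deriv_add (hf.2 k k.lt_succ_self) (hg.differentiable_iteratedDeriv k (by exact_mod_cast WithTop.coe_lt_top _) x)

theorem diffTimesAt_of_contDiffAt {s : ℕ} {f : ℝ → ℝ} {x : ℝ} (hf : ContDiffAt ℝ s f x) :
    DiffTimesAt s f x := by
  have h : ∀ j < s, ∀ᶠ y in 𝓝 x, DifferentiableAt ℝ (iteratedDeriv j f) y := by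
    intro j hj
    filter_upwards [hf.eventually (by simp)] with y hy
    rw [← iteratedDerivWithin_univ]
    exact (ContDiffWithinAt.differentiableWithinAt_iteratedDerivWithin (s := Set.univ) hy
      (by exact_mod_cast hj) (by simp [uniqueDiffOn_univ])).differentiableAt univ_mem
  exact ⟨fun j hj => h j (by omega), fun j hj => (h j hj).self_of_nhds⟩

/-- The differentiability set of an arbitrary real function is Borel, and the points near which a
property holds eventually form an open set. -/
theorem measurableSet_diffTimesAt (k : ℕ) (f : ℝ → ℝ) :
    MeasurableSet {x | DiffTimesAt k f x} := by
  have h1 : ∀ j, MeasurableSet {x | DifferentiableAt ℝ (iteratedDeriv j f) x} := fun j =>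
    measurableSet_of_differentiableAt ℝ _
  simp only [DiffTimesAt, Set.ofPred_and, Set.ofPred_forall]
  refine MeasurableSet.inter (.iInter fun j => .iInter fun _ => ?_)
    (.iInter fun j => .iInter fun _ => h1 j)
  exact isOpen_setOfPred_eventually_nhds.measurableSet

/-! ### Flat-topped bumps of zero mean. -/

/-- A profile for perturbing a density around a point: smooth, supported in `[-2, 2]`, equal to
`1` near `0`, and of zero mean. -/
structure IsProfile (φ : ℝ → ℝ) : Prop where
  contDiff : ContDiff ℝ ∞ φ
  abs_le_one : ∀ u, |φ u| ≤ 1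
  eq_zero : ∀ u, 2 < |u| → φ u = 0
  eventually_eq_one : φ =ᶠ[𝓝 0] fun _ => 1
  integral_eq_zero : ∫ u, φ u = 0

theorem exists_isProfile : ∃ φ : ℝ → ℝ, IsProfile φ := by
  let ψ : ContDiffBump (0 : ℝ) := ⟨1 / 4, 1 / 2, by norm_num, by norm_num⟩
  have hψc : ContDiff ℝ ∞ (ψ : ℝ → ℝ) := ψ.contDiff
  have hz : ∀ x : ℝ, 1 / 2 ≤ |x| → ψ x = 0 := fun x hx =>
    ψ.zero_of_le_dist (by rw [Real.dist_eq, sub_zero]; exact hx)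
  have hint : Integrable (ψ : ℝ → ℝ) := ψ.continuous.integrable_of_hasCompactSupport
    ψ.hasCompactSupport
  -- Subtracting a translate cancels the mass. The translate vanishes for `|u - 1| ≥ 1 / 2`, so the
  -- plateau of `ψ` near `0` survives.
  refine ⟨fun u => ψ u - ψ (u - 1), ?_, fun u => ?_, fun u hu => ?_, ?_, ?_⟩
  · exact hψc.sub (hψc.comp (contDiff_id.sub contDiff_const))
  · have h1 := ψ.nonneg (x := u)
    have h2 := ψ.le_one (x := u)
    have h3 := ψ.nonneg (x := u - 1)
    have h4 := ψ.le_one (x := u - 1)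
    rw [abs_le]
    constructor <;> linarith
  · have h1 : 1 / 2 ≤ |u - 1| := by
      have := abs_sub_abs_le_abs_sub u 1
      rw [abs_one] at this
      linarith
    change ψ u - ψ (u - 1) = 0
    rw [hz u (by linarith), hz (u - 1) h1, sub_zero]
  · have hnear : ∀ᶠ u : ℝ in 𝓝 0, |u| < 1 / 4 := by
      have : Metric.ball (0 : ℝ) (1 / 4) ∈ 𝓝 (0 : ℝ) := Metric.ball_mem_nhds _ (by norm_num)
      filter_upwards [this] with u hu
      simpa [Real.dist_eq] using hu
    filter_upwards [hnear] with u hu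
    have h1 : ψ u = 1 := ψ.one_of_mem_closedBall (by
      rw [Metric.mem_closedBall, Real.dist_eq, sub_zero]
      exact hu.le)
    have h2 : 1 / 2 ≤ |u - 1| := by
      rw [abs_lt] at hu
      rw [abs_of_neg (by linarith)]
      linarith
    rw [h1, hz _ h2, sub_zero]
  · rw [integral_sub hint (hint.comp_sub_right 1), integral_sub_right_eq_self (ψ : ℝ → ℝ) 1,
      sub_self]

theorem IsProfile.iteratedDeriv_eq_zero {φ : ℝ → ℝ} (hφ : IsProfile φ) (k : ℕ) {u : ℝ}
    (hu : 2 < |u|) : iteratedDeriv k φ u = 0 := by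
  have h : φ =ᶠ[𝓝 u] fun _ => 0 := by
    filter_upwards [(isOpen_lt continuous_const continuous_abs).mem_nhds hu] with v hv
    exact hφ.eq_zero v hv
  rw [h.iteratedDeriv_eq]
  simp

/-- Flatness at the centre makes the constraint on the `s`-th derivative at `x₀` cost nothing. -/
theorem IsProfile.iteratedDeriv_zero {φ : ℝ → ℝ} (hφ : IsProfile φ) {k : ℕ} (hk : 1 ≤ k) :
    iteratedDeriv k φ 0 = 0 := by
  rw [hφ.eventually_eq_one.iteratedDeriv_eq, iteratedDeriv_const, if_neg (by omega)]

theorem IsProfile.apply_zero {φ : ℝ → ℝ} (hφ : IsProfile φ) : φ 0 = 1 :=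
  hφ.eventually_eq_one.self_of_nhds

theorem IsProfile.exists_bound {φ : ℝ → ℝ} (hφ : IsProfile φ) (s : ℕ) :
    ∃ B, 0 ≤ B ∧ ∀ k ≤ s, ∀ u, |iteratedDeriv k φ u| ≤ B := by
  have h : ∀ k : ℕ, ∃ B, 0 ≤ B ∧ ∀ u, |iteratedDeriv k φ u| ≤ B := by
    intro k
    have hc : Continuous (iteratedDeriv k φ) :=
      hφ.contDiff.continuous_iteratedDeriv k (by exact_mod_cast le_top)
    obtain ⟨B, hB⟩ := (isCompact_Icc (a := (-2 : ℝ)) (b := 2)).exists_bound_of_continuousOn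
      hc.continuousOn
    refine ⟨max B 0, le_max_right _ _, fun u => ?_⟩
    by_cases hu : 2 < |u|
    · rw [hφ.iteratedDeriv_eq_zero k hu, abs_zero]
      exact le_max_right _ _
    · exact (hB u (abs_le.1 (not_lt.1 hu))).trans (le_max_left _ _)
  choose B hB0 hB using h
  refine ⟨∑ k ∈ Finset.range (s + 1), B k, Finset.sum_nonneg fun k _ => hB0 k,
    fun k hk u => (hB k u).trans ?_⟩
  exact Finset.single_le_sum (f := B) (fun k _ => hB0 k) (Finset.mem_range.2 (by omega))

/-- The profile `φ` rescaled to height `a` and width `h` around `x₀`. -/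
noncomputable def bump (φ : ℝ → ℝ) (x₀ a h : ℝ) (x : ℝ) : ℝ := a * φ (h⁻¹ * (x - x₀))

theorem contDiff_bump {φ : ℝ → ℝ} (hφ : IsProfile φ) (x₀ a h : ℝ) :
    ContDiff ℝ ∞ (bump φ x₀ a h) :=
  contDiff_const.mul (hφ.contDiff.comp (contDiff_const.mul (contDiff_id.sub contDiff_const)))

theorem iteratedDeriv_bump {φ : ℝ → ℝ} (hφ : IsProfile φ) (x₀ a h : ℝ) (k : ℕ) (x : ℝ) :
    iteratedDeriv k (bump φ x₀ a h) x
      = a * (h⁻¹ ^ k * iteratedDeriv k φ (h⁻¹ * (x - x₀))) := by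
  have h1 : bump φ x₀ a h = fun x => a * (fun y => (fun z => φ (h⁻¹ * z)) (y - x₀)) x := rfl
  have h2 := iteratedDeriv_comp_sub_const k (fun z => φ (h⁻¹ * z)) x₀
  rw [h1, iteratedDeriv_const_mul_field, h2,
    iteratedDeriv_comp_const_mul (hφ.contDiff.of_le (by exact_mod_cast le_top))]

theorem bump_self {φ : ℝ → ℝ} (hφ : IsProfile φ) (x₀ a h : ℝ) : bump φ x₀ a h x₀ = a := by
  simp [bump, hφ.apply_zero]

theorem abs_bump_le {φ : ℝ → ℝ} (hφ : IsProfile φ) (x₀ : ℝ) {a : ℝ} (ha : 0 ≤ a) (h x : ℝ) :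
    |bump φ x₀ a h x| ≤ a := by
  rw [bump, abs_mul, abs_of_nonneg ha]
  exact mul_le_of_le_one_right ha (hφ.abs_le_one _)

theorem two_lt_abs_rescale {x₀ h x : ℝ} (hh : 0 < h) (hx : 2 * h < |x - x₀|) :
    2 < |h⁻¹ * (x - x₀)| := by
  rw [abs_mul, abs_of_pos (inv_pos.2 hh), inv_mul_eq_div, lt_div_iff₀ hh]
  exact hx

theorem bump_eq_zero {φ : ℝ → ℝ} (hφ : IsProfile φ) {x₀ a h x : ℝ} (hh : 0 < h)
    (hx : 2 * h < |x - x₀|) : bump φ x₀ a h x = 0 := by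
  rw [bump, hφ.eq_zero _ (two_lt_abs_rescale hh hx), mul_zero]

theorem integral_bump {φ : ℝ → ℝ} (hφ : IsProfile φ) (x₀ a h : ℝ) :
    ∫ x, bump φ x₀ a h x = 0 := by
  have h1 : ∫ x, φ (h⁻¹ * (x - x₀)) = ∫ x, φ (h⁻¹ * x) :=
    integral_sub_right_eq_self (fun x => φ (h⁻¹ * x)) x₀
  simp only [bump]
  rw [integral_const_mul, h1, Measure.integral_comp_mul_left, hφ.integral_eq_zero]
  simp

theorem lintegral_le_of_support {x₀ h c : ℝ} (F : ℝ → ℝ)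
    (hF : ∀ x, F x ≤ c) (hF0 : ∀ x, 2 * h < |x - x₀| → F x = 0) (hc : 0 ≤ c) :
    ∫⁻ x, ENNReal.ofReal (F x) ≤ ENNReal.ofReal (4 * h * c) := by
  have hle : ∀ x, ENNReal.ofReal (F x)
      ≤ (Set.Icc (x₀ - 2 * h) (x₀ + 2 * h)).indicator (fun _ => ENNReal.ofReal c) x := by
    intro x
    by_cases hx : x ∈ Set.Icc (x₀ - 2 * h) (x₀ + 2 * h)
    · rw [Set.indicator_of_mem hx]
      exact ENNReal.ofReal_le_ofReal (hF x)
    · rw [hF0 x, ENNReal.ofReal_zero]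
      · exact zero_le
      · by_contra hcon
        rw [not_lt, abs_le] at hcon
        exact hx ⟨by linarith, by linarith⟩
  refine (lintegral_mono hle).trans ?_
  rw [lintegral_indicator measurableSet_Icc, setLIntegral_const, Real.volume_Icc, mul_comm,
    ← ENNReal.ofReal_mul' hc]
  exact ENNReal.ofReal_le_ofReal (by ring_nf; rfl)

theorem integrable_bump {φ : ℝ → ℝ} (hφ : IsProfile φ) {x₀ a h : ℝ} (ha : 0 ≤ a) (hh : 0 < h) :
    Integrable (bump φ x₀ a h) := by
  refine ⟨(contDiff_bump hφ x₀ a h).continuous.aestronglyMeasurable, ?_⟩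
  rw [hasFiniteIntegral_iff_norm]
  refine lt_of_le_of_lt (lintegral_le_of_support (x₀ := x₀) (h := h) (c := a) _
    (fun x => abs_bump_le hφ x₀ ha h x) (fun x hx => ?_) ha) ENNReal.ofReal_lt_top
  rw [bump_eq_zero hφ hh hx, norm_zero]

/-! ### Perturbed densities and their membership in the local class. -/

theorem IsDensityOn.integrable {S : Set ℝ} {f : ℝ → ℝ} (hf : IsDensityOn S f) :
    Integrable f := by
  refine ⟨hf.measurable.aestronglyMeasurable, ?_⟩
  rw [hasFiniteIntegral_iff_ofReal (ae_of_all _ hf.nonneg), hf.total]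
  exact ENNReal.one_lt_top

theorem IsDensityOn.integral_eq_one {S : Set ℝ} {f : ℝ → ℝ} (hf : IsDensityOn S f) :
    ∫ x, f x = 1 := by
  rw [integral_eq_lintegral_of_nonneg_ae (ae_of_all _ hf.nonneg)
    hf.measurable.aestronglyMeasurable, hf.total, ENNReal.toReal_one]

theorem IsDensityOn.isProbabilityMeasure {S : Set ℝ} {f : ℝ → ℝ} (hf : IsDensityOn S f) :
    IsProbabilityMeasure (volume.withDensity fun y => ENNReal.ofReal (f y)) :=
  ⟨by rw [withDensity_apply _ MeasurableSet.univ, Measure.restrict_univ, hf.total]⟩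

/-- Positivity survives because `a ≤ b`, and total mass because the bump has zero mean. As `f₀ ≥ b >
0` on the window, the window lies inside `S`, so the support condition survives too. -/
theorem IsDensityOn.add_bump {S : Set ℝ} {f₀ φ : ℝ → ℝ} (hf₀ : IsDensityOn S f₀)
    (hφ : IsProfile φ) {x₀ a h b : ℝ} (ha : 0 ≤ a) (hh : 0 < h) (hb : 0 < b) (hab : a ≤ b)
    (hfb : ∀ x, |x - x₀| ≤ 2 * h → b ≤ f₀ x) : IsDensityOn S (f₀ + bump φ x₀ a h) := by
  have hnn : ∀ x, 0 ≤ (f₀ + bump φ x₀ a h) x := by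
    intro x
    rw [Pi.add_apply]
    by_cases hx : |x - x₀| ≤ 2 * h
    · have h1 := abs_le.1 (abs_bump_le hφ x₀ ha h x)
      linarith [hfb x hx, h1.1]
    · rw [bump_eq_zero hφ hh (not_le.1 hx), add_zero]
      exact hf₀.nonneg x
  refine ⟨hf₀.measurable.add (contDiff_bump hφ x₀ a h).continuous.measurable, hnn,
    fun x hx => ?_, ?_⟩
  · have h0 := hf₀.support x hx
    have hx' : 2 * h < |x - x₀| := by
      by_contra hcon
      have := hfb x (not_lt.1 hcon)
      linarith
    rw [Pi.add_apply, h0, bump_eq_zero hφ hh hx', add_zero]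
  · rw [← ofReal_integral_eq_lintegral_ofReal (hf₀.integrable.add (integrable_bump hφ ha hh))
      (ae_of_all _ hnn), integral_add' hf₀.integrable (integrable_bump hφ ha hh),
      hf₀.integral_eq_one, integral_bump hφ, add_zero, ENNReal.ofReal_one]

theorem self_mem_localClass {S : Set ℝ} {s : ℕ} {f₀ : ℝ → ℝ} {x₀ M δ ε : ℝ}
    (hf₀ : IsDensityOn S f₀) (hd : DiffTimesAt s f₀ x₀) (hM : 0 ≤ M) :
    f₀ ∈ localClass S s f₀ x₀ M δ ε := by
  refine ⟨⟨hf₀, hd, le_mul_of_one_le_left (abs_nonneg _) (by linarith)⟩,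
    fun k _ => ⟨fun _ _ hx => hx, ?_⟩⟩
  simp

theorem add_bump_mem_localClass {S : Set ℝ} {s : ℕ} (hs : 1 ≤ s) {f₀ φ : ℝ → ℝ}
    {x₀ M δ ε : ℝ} (hf₀ : IsDensityOn S f₀) (hd : DiffTimesAt s f₀ x₀) (hM : 0 ≤ M)
    (hφ : IsProfile φ) {a h b B : ℝ} (ha : 0 ≤ a) (hh : 0 < h) (hh1 : h ≤ 1) (hb : 0 < b)
    (hab : a ≤ b) (hfb : ∀ x, |x - x₀| ≤ 2 * h → b ≤ f₀ x)
    (hB : ∀ k ≤ s, ∀ u, |iteratedDeriv k φ u| ≤ B)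
    (hδ : 4 * h * (a * (h⁻¹ ^ s * B)) ≤ δ) :
    f₀ + bump φ x₀ a h ∈ localClass S s f₀ x₀ M δ ε := by
  have hg := contDiff_bump hφ x₀ a h
  have hB0 : 0 ≤ B := (abs_nonneg _).trans (hB 0 (Nat.zero_le _) 0)
  refine ⟨⟨hf₀.add_bump hφ ha hh hb hab hfb, hd.add hg, ?_⟩,
    fun k hk => ⟨fun x _ hx => hx.add hg, ?_⟩⟩
  · rw [hd.iteratedDeriv_add hg, iteratedDeriv_bump hφ, sub_self, mul_zero,
      hφ.iteratedDeriv_zero hs, mul_zero, mul_zero, add_zero]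
    exact le_mul_of_one_le_left (abs_nonneg _) (by linarith)
  · have hmeas : MeasurableSet {x | |x - x₀| ≤ ε ∧ DiffTimesAt k f₀ x} :=
      (measurableSet_le (f := fun x => |x - x₀|) (by fun_prop) measurable_const).inter
        (measurableSet_diffTimesAt k f₀)
    calc _ = ∫⁻ x in {x | |x - x₀| ≤ ε ∧ DiffTimesAt k f₀ x},
          ENNReal.ofReal |iteratedDeriv k (bump φ x₀ a h) x| := by
          refine setLIntegral_congr_fun hmeas fun x hx => ?_
          simp only [hx.2.iteratedDeriv_add hg, add_sub_cancel_left]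
      -- Passing to the whole line makes the bound uniform in `ε`. Below, `h ≤ 1` lets order `s`
      -- dominate all lower orders.
      _ ≤ ∫⁻ x, ENNReal.ofReal |iteratedDeriv k (bump φ x₀ a h) x| := setLIntegral_le_lintegral _ _
      _ ≤ ENNReal.ofReal (4 * h * (a * (h⁻¹ ^ s * B))) := by
          refine lintegral_le_of_support (x₀ := x₀) _ (fun x => ?_) (fun x hx => ?_)
            (by positivity)
          · rw [iteratedDeriv_bump hφ, abs_mul, abs_mul, abs_of_nonneg ha,
              abs_of_nonneg (by positivity)]
            gcongr
            · exact (one_le_inv₀ hh).2 hh1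
            · exact hB k hk _
          · rw [iteratedDeriv_bump hφ, hφ.iteratedDeriv_eq_zero k (two_lt_abs_rescale hh hx)]
            simp
      _ ≤ ENNReal.ofReal δ := ENNReal.ofReal_le_ofReal hδ

/-! ### From the `χ²` divergence to the minimax risk. -/

/-- The likelihood ratio of one observation has second moment `1 + ∫ g² / f₀ ≤ exp (4 h a² / b)`,
and second moments multiply over independent observations. -/
theorem two_point_risk_bound {S : Set ℝ} {f₀ φ : ℝ → ℝ} (hf₀ : IsDensityOn S f₀)
    (hφ : IsProfile φ) {x₀ a h b : ℝ} (ha : 0 ≤ a) (hh : 0 < h) (hb : 0 < b) (hab : a ≤ b)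
    (hfb : ∀ x, |x - x₀| ≤ 2 * h → b ≤ f₀ x) (n : ℕ) (T : (Fin n → ℝ) → ℝ)
    (hT : Measurable T) :
    ENNReal.ofReal (a ^ 2 / 2) ≤
      ENNReal.ofReal (Real.exp (n * (4 * h * (a ^ 2 / b)))) * risk n f₀ x₀ T
        + risk n (f₀ + bump φ x₀ a h) x₀ T := by
  set g := bump φ x₀ a h with hg
  have hgm : Measurable g := (contDiff_bump hφ x₀ a h).continuous.measurable
  have hgi : Integrable g := integrable_bump hφ ha hh
  have hf₁ : IsDensityOn S (f₀ + g) := hf₀.add_bump hφ ha hh hb hab hfb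
  have hP₀ := hf₀.isProbabilityMeasure
  have hP₁ := hf₁.isProbabilityMeasure
  set μ : Measure ℝ := volume.withDensity fun y => ENNReal.ofReal (f₀ y) with hμ
  have hfm : Measurable fun y => ENNReal.ofReal (f₀ y) := hf₀.measurable.ennreal_ofReal
  -- Where `f₀ x = 0`, division by zero gives `l x = 1`. This is harmless because `g` vanishes there
  -- too.
  let l : ℝ → ℝ := fun x => 1 + g x / f₀ x
  have hlm : Measurable l := measurable_const.add (hgm.div hf₀.measurable)
  have hg0 : ∀ x, f₀ x = 0 → g x = 0 := by
    intro x hx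
    refine bump_eq_zero hφ hh ?_
    by_contra hcon
    linarith [hfb x (not_lt.1 hcon)]
  have hfl : ∀ x, f₀ x * l x = f₀ x + g x := by
    intro x
    rcases eq_or_ne (f₀ x) 0 with hx | hx
    · simp [hx, hg0 x hx]
    · simp only [l]; field_simp
  have hfl2 : ∀ x, f₀ x * l x ^ 2 = f₀ x + 2 * g x + g x ^ 2 / f₀ x := by
    intro x
    rcases eq_or_ne (f₀ x) 0 with hx | hx
    · simp [hx, hg0 x hx]
    · simp only [l]; field_simp; ring
  have hl0 : ∀ x, 0 ≤ l x := by
    intro x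
    rcases (hf₀.nonneg x).eq_or_lt with hx | hx
    · simp [l, ← hx]
    · have h1 := hf₁.nonneg x
      rw [Pi.add_apply, ← hfl x] at h1
      exact nonneg_of_mul_nonneg_right h1 hx
  have hdens : μ.withDensity (fun x => ENNReal.ofReal (l x))
      = volume.withDensity fun y => ENNReal.ofReal ((f₀ + g) y) := by
    rw [hμ, ← withDensity_mul _ hfm hlm.ennreal_ofReal]
    congr 1
    funext x
    rw [Pi.mul_apply, ← ENNReal.ofReal_mul (hf₀.nonneg x), hfl x, Pi.add_apply]
  have hl1 : ∫⁻ x, ENNReal.ofReal (l x) ∂μ = 1 := by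
    rw [← hf₁.total, hμ, lintegral_withDensity_eq_lintegral_mul _ hfm hlm.ennreal_ofReal]
    refine lintegral_congr fun x => ?_
    rw [Pi.mul_apply, ← ENNReal.ofReal_mul (hf₀.nonneg x), hfl x, Pi.add_apply]
  have hq0 : ∀ x, 0 ≤ g x ^ 2 / f₀ x := fun x => div_nonneg (sq_nonneg _) (hf₀.nonneg x)
  have hq : ∫⁻ x, ENNReal.ofReal (g x ^ 2 / f₀ x) ≤ ENNReal.ofReal (4 * h * (a ^ 2 / b)) := by
    refine lintegral_le_of_support (x₀ := x₀) _ (fun x => ?_) (fun x hx => ?_) (by positivity)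
    · by_cases hx : |x - x₀| ≤ 2 * h
      · have h1 := hfb x hx
        have h2 : g x ^ 2 ≤ a ^ 2 := sq_le_sq' (abs_le.1 (abs_bump_le hφ x₀ ha h x)).1
          (abs_le.1 (abs_bump_le hφ x₀ ha h x)).2
        gcongr
      · rw [hg, bump_eq_zero hφ hh (not_le.1 hx)]
        simp only [ne_eq, OfNat.ofNat_ne_zero, not_false_eq_true, zero_pow, zero_div]
        positivity
    · rw [hg, bump_eq_zero hφ hh hx]
      simp
  have hq1 : 0 ≤ 4 * h * (a ^ 2 / b) := by positivity
  have hl2 : ∫⁻ x, ENNReal.ofReal (l x ^ 2) ∂μ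
      ≤ ENNReal.ofReal (Real.exp (4 * h * (a ^ 2 / b))) := by
    rw [hμ, lintegral_withDensity_eq_lintegral_mul _ hfm (hlm.pow_const 2).ennreal_ofReal]
    have hlin : ∀ x, 0 ≤ f₀ x + 2 * g x + g x ^ 2 / f₀ x := fun x => by
      rw [← hfl2 x]
      exact mul_nonneg (hf₀.nonneg x) (sq_nonneg _)
    have hqi : Integrable fun x => g x ^ 2 / f₀ x := by
      refine ⟨((hgm.pow_const 2).div hf₀.measurable).aestronglyMeasurable, ?_⟩
      rw [hasFiniteIntegral_iff_ofReal (ae_of_all _ hq0)]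
      exact hq.trans_lt ENNReal.ofReal_lt_top
    have hsum : Integrable fun x => f₀ x + 2 * g x := hf₀.integrable.add (hgi.const_mul 2)
    calc _ = ∫⁻ x, ENNReal.ofReal (f₀ x + 2 * g x + g x ^ 2 / f₀ x) := by
          refine lintegral_congr fun x => ?_
          rw [Pi.mul_apply, ← ENNReal.ofReal_mul (hf₀.nonneg x), hfl2 x]
      -- The cross term `2 * ∫ g` vanishes by the zero mean, so the cost is quadratic in the height.
      _ = ENNReal.ofReal (1 + ∫ x, g x ^ 2 / f₀ x) := by
          have h1 := ofReal_integral_eq_lintegral_ofReal (hsum.add hqi) (ae_of_all _ hlin)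
          refine h1.symm.trans ?_
          rw [integral_add' hsum hqi, integral_add hf₀.integrable (hgi.const_mul 2),
            integral_const_mul, hf₀.integral_eq_one, integral_bump hφ, mul_zero, add_zero]
      _ ≤ ENNReal.ofReal (Real.exp (4 * h * (a ^ 2 / b))) := by
          refine ENNReal.ofReal_le_ofReal ?_
          have h1 : ∫ x, g x ^ 2 / f₀ x ≤ 4 * h * (a ^ 2 / b) := by
            rw [← ofReal_integral_eq_lintegral_ofReal hqi (ae_of_all _ hq0)] at hq
            exact (ENNReal.ofReal_le_ofReal_iff hq1).1 hq
          have h2 := Real.add_one_le_exp (4 * h * (a ^ 2 / b))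
          linarith
  have hprod : ∀ X : Fin n → ℝ, ENNReal.ofReal (∏ i, l (X i)) = ∏ i, ENNReal.ofReal (l (X i)) :=
    fun X => ENNReal.ofReal_prod_of_nonneg fun i _ => hl0 _
  have hprod2 : ∀ X : Fin n → ℝ,
      ENNReal.ofReal ((∏ i, l (X i)) ^ 2) = ∏ i, ENNReal.ofReal (l (X i) ^ 2) := fun X => by
    rw [← Finset.prod_pow]
    exact ENNReal.ofReal_prod_of_nonneg fun i _ => sq_nonneg _
  have hlaw : sampleLaw n (f₀ + g) = (sampleLaw n f₀).withDensity
      fun X => ENNReal.ofReal (∏ i, l (X i)) := by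
    have : IsProbabilityMeasure (μ.withDensity fun x => ENNReal.ofReal (l x)) := by
      rw [hdens]; exact hP₁
    simp only [hprod]
    rw [sampleLaw, ← hdens]
    exact pi_withDensity_prod n μ _ hlm.ennreal_ofReal
  have key := two_point_bound (sampleLaw n f₀) (fun X => ∏ i, l (X i))
    (Finset.measurable_prod _ fun i _ => hlm.comp (measurable_pi_apply i))
    (fun X => Finset.prod_nonneg fun i _ => hl0 _) ?_
    (Real.exp (n * (4 * h * (a ^ 2 / b)))) (Real.exp_pos _) ?_ T hT (f₀ x₀) ((f₀ + g) x₀)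
  · rw [← hlaw] at key
    refine le_trans (le_of_eq ?_) key
    rw [Pi.add_apply, hg, bump_self hφ, sub_add_cancel_left, abs_neg, sq_abs]
  · simp only [hprod]
    rw [sampleLaw, lintegral_pi_prod μ _ fun _ => hlm.ennreal_ofReal]
    simp [hl1]
  · simp only [hprod2]
    rw [sampleLaw, lintegral_pi_prod μ (fun _ x => ENNReal.ofReal (l x ^ 2))
      fun _ => (hlm.pow_const 2).ennreal_ofReal, Finset.prod_const, Finset.card_univ,
      Fintype.card_fin, Real.exp_nat_mul, ENNReal.ofReal_pow (Real.exp_pos _).le]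
    exact pow_le_pow_left' hl2 n

/-! ### Choice of rates and divergence of the minimax risk. -/

theorem tendsto_natCast_rpow_neg {y : ℝ} (hy : y < 0) :
    Tendsto (fun n : ℕ => (n : ℝ) ^ y) atTop (𝓝 0) := by
  have h := (tendsto_rpow_neg_atTop (neg_pos.2 hy)).comp tendsto_natCast_atTop_atTop
  simpa [Function.comp_def] using h

/-- If a density bounded below near `x₀` and its perturbation both belong to a class, then the
scaled minimax risk over the class is bounded below by the squared height of the perturbation. -/
theorem le_scaledMinimaxRisk {S : Set ℝ} {f₀ φ : ℝ → ℝ} (hf₀ : IsDensityOn S f₀)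
    (hφ : IsProfile φ) {x₀ a h b : ℝ} (ha : 0 ≤ a) (hh : 0 < h) (hb : 0 < b) (hab : a ≤ b)
    (hfb : ∀ x, |x - x₀| ≤ 2 * h → b ≤ f₀ x) (s n : ℕ) {U : Set (ℝ → ℝ)} (h₀ : f₀ ∈ U)
    (h₁ : f₀ + bump φ x₀ a h ∈ U) {χ : ℝ}
    (hχ : Real.exp (n * (4 * h * (a ^ 2 / b))) ≤ χ) :
    ENNReal.ofReal ((n : ℝ) ^ (2 * s / (2 * s + 1) : ℝ) * (a ^ 2 / 2) / (χ + 1))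
      ≤ scaledMinimaxRisk s n x₀ U := by
  have hχ0 : 0 < χ := (Real.exp_pos _).trans_le hχ
  rw [scaledMinimaxRisk]
  refine le_iInf₂ fun T hT => ?_
  set w : ℝ := (n : ℝ) ^ (2 * s / (2 * s + 1) : ℝ) with hw
  have hw0 : 0 ≤ w := Real.rpow_nonneg (Nat.cast_nonneg n) _
  set R := ⨆ f ∈ U, ENNReal.ofReal w * risk n f x₀ T with hR
  have hle : ∀ f ∈ U, ENNReal.ofReal w * risk n f x₀ T ≤ R := fun f hf =>
    le_iSup₂ (f := fun f (_ : f ∈ U) => ENNReal.ofReal w * risk n f x₀ T) f hf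
  rw [ENNReal.ofReal_div_of_pos (by linarith), ENNReal.ofReal_mul hw0]
  refine ENNReal.div_le_of_le_mul' ?_
  calc ENNReal.ofReal w * ENNReal.ofReal (a ^ 2 / 2)
      ≤ ENNReal.ofReal w * (ENNReal.ofReal χ * risk n f₀ x₀ T
          + risk n (f₀ + bump φ x₀ a h) x₀ T) := by
        gcongr
        refine (two_point_risk_bound hf₀ hφ ha hh hb hab hfb n T hT).trans ?_
        gcongr
    _ = ENNReal.ofReal χ * (ENNReal.ofReal w * risk n f₀ x₀ T)
          + ENNReal.ofReal w * risk n (f₀ + bump φ x₀ a h) x₀ T := by ring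
    _ ≤ ENNReal.ofReal χ * R + R := by
        gcongr
        · exact hle _ h₀
        · exact hle _ h₁
    _ = ENNReal.ofReal (χ + 1) * R := by
        rw [ENNReal.ofReal_add hχ0.le zero_le_one, ENNReal.ofReal_one, add_mul, one_mul]

/-- Where `f₀ x₀ > 0`, the minimax risk over the local classes of radius `c₀ n ^ (-r)` is of larger
order than `n ^ (-2s / (2s + 1))`: perturbations of `f₀` of width `n ^ (-β)` and height
`n ^ (-(1 - β) / 2)` are indistinguishable from `f₀` and stay in the classes for some
`β > 1 / (2s + 1)`. -/
theorem tendsto_scaledMinimaxRisk_localClass {S : Set ℝ} {s : ℕ} (hs : 1 ≤ s) {x₀ : ℝ}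
    {f₀ : ℝ → ℝ} (hf₀ : IsDensityOn S f₀) (hsmooth : ContDiffAt ℝ s f₀ x₀) (hpos : 0 < f₀ x₀)
    {M : ℝ} (hM : 0 ≤ M) {c₀ : ℝ} (hc₀ : 0 < c₀) {r : ℝ} (hr0 : 0 ≤ r)
    (hr : r < 1 / (2 * s + 1)) (ε : ℝ) :
    Tendsto (fun n : ℕ => scaledMinimaxRisk s n x₀
      (localClass S s f₀ x₀ M (c₀ * (n : ℝ) ^ (-r)) ε)) atTop (𝓝 ⊤) := by
  obtain ⟨φ, hφ⟩ := exists_isProfile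
  obtain ⟨B, hB0, hB⟩ := hφ.exists_bound s
  have hd := diffTimesAt_of_contDiffAt hsmooth
  set b := f₀ x₀ / 2 with hb_def
  have hb : 0 < b := by positivity
  obtain ⟨ρ, hρ, hfρ⟩ : ∃ ρ > 0, ∀ x, |x - x₀| < ρ → b ≤ f₀ x := by
    have h1 : ∀ᶠ x in 𝓝 x₀, b < f₀ x :=
      hsmooth.continuousAt.eventually (lt_mem_nhds (half_lt_self hpos))
    obtain ⟨ρ, hρ, h⟩ := Metric.eventually_nhds_iff.1 h1
    exact ⟨ρ, hρ, fun x hx => (h (by rwa [Real.dist_eq])).le⟩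
  have hs' : (1 : ℝ) ≤ s := by exact_mod_cast hs
  set q : ℝ := 1 / (2 * s + 1) with hq
  have hq0 : 0 < q := by positivity
  have hqs : q * (2 * s + 1) = 1 := by rw [hq]; field_simp
  -- The last exponent is that of `h * a * h ^ (-s)` relative to `n ^ (-r)`. At `β = q` it equals `r
  -- - q < 0`, so there is room to increase `β`. With `β = q + η` it is `r - q + η * (2s - 1) / 2`,
  -- still negative for `η = (q - r) / (2s)`.
  obtain ⟨β, hβq, hβ1, hβe⟩ : ∃ β : ℝ, q < β ∧ β < 1 ∧ β * (2 * s - 1) / 2 - 1 / 2 + r < 0 := by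
    have hη : (q - r) / (2 * s) * (2 * s) = q - r := by field_simp
    have hη0 : 0 < (q - r) / (2 * s) := div_pos (sub_pos.2 hr) (by positivity)
    set η := (q - r) / (2 * s)
    refine ⟨q + η, by linarith, ?_, ?_⟩
    · nlinarith
    · nlinarith
  have hβ0 : 0 < β := hq0.trans hβq
  set h : ℕ → ℝ := fun n => (n : ℝ) ^ (-β) with hh_def
  set a : ℕ → ℝ := fun n => (n : ℝ) ^ (-((1 - β) / 2)) with ha_def
  have hh_lim : Tendsto h atTop (𝓝 0) := tendsto_natCast_rpow_neg (by linarith)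
  have ha_lim : Tendsto a atTop (𝓝 0) := tendsto_natCast_rpow_neg (by linarith)
  have he_lim : Tendsto (fun n : ℕ => 4 * B * (n : ℝ) ^ (β * (2 * s - 1) / 2 - 1 / 2 + r))
      atTop (𝓝 0) := by
    simpa using (tendsto_natCast_rpow_neg hβe).const_mul (4 * B)
  have hlow : Tendsto (fun n : ℕ => ENNReal.ofReal
      ((n : ℝ) ^ (β - q) / (2 * (Real.exp (4 / b) + 1)))) atTop (𝓝 ⊤) := by
    refine ENNReal.tendsto_ofReal_atTop.comp (Tendsto.atTop_div_const (by positivity) ?_)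
    exact (tendsto_rpow_atTop (sub_pos.2 hβq)).comp tendsto_natCast_atTop_atTop
  refine tendsto_nhds_top_mono hlow ?_
  filter_upwards [hh_lim.eventually (gt_mem_nhds (half_pos hρ)),
    hh_lim.eventually (gt_mem_nhds one_pos), ha_lim.eventually (gt_mem_nhds hb),
    he_lim.eventually (gt_mem_nhds hc₀), eventually_gt_atTop 0] with n hn1 hn2 hn3 hn4 hn5
  have hn : (0 : ℝ) < n := by exact_mod_cast hn5
  have hh : 0 < h n := Real.rpow_pos_of_pos hn _
  have ha : 0 < a n := Real.rpow_pos_of_pos hn _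
  have hfb : ∀ x, |x - x₀| ≤ 2 * h n → b ≤ f₀ x := fun x hx => hfρ x (by linarith)
  have ha2 : a n ^ 2 = (n : ℝ) ^ (β - 1) := by
    rw [ha_def, ← Real.rpow_natCast, ← Real.rpow_mul hn.le]
    congr 1; push_cast; ring
  have hδ : 4 * h n * (a n * ((h n)⁻¹ ^ s * B)) ≤ c₀ * (n : ℝ) ^ (-r) := by
    have h1 : (h n)⁻¹ ^ s = (n : ℝ) ^ (β * s) := by
      rw [hh_def, ← Real.rpow_neg hn.le, neg_neg, ← Real.rpow_natCast, ← Real.rpow_mul hn.le]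
    have h2 : 4 * h n * (a n * ((h n)⁻¹ ^ s * B))
        = 4 * B * (n : ℝ) ^ (β * (2 * s - 1) / 2 - 1 / 2 + r) * (n : ℝ) ^ (-r) := by
      have h3 : h n * (a n * (h n)⁻¹ ^ s)
          = (n : ℝ) ^ (β * (2 * s - 1) / 2 - 1 / 2 + r) * (n : ℝ) ^ (-r) := by
        rw [h1, hh_def, ha_def, ← Real.rpow_add hn, ← Real.rpow_add hn, ← Real.rpow_add hn]
        congr 1; ring
      rw [mul_assoc (4 * B), ← h3]; ring
    rw [h2]
    gcongr
  have hχ : Real.exp (n * (4 * h n * (a n ^ 2 / b))) ≤ Real.exp (4 / b) := by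
    have h1 : (n : ℝ) * (h n * a n ^ 2) = 1 := by
      rw [ha2, hh_def, ← Real.rpow_add hn, show -β + (β - 1) = (-1 : ℝ) by ring,
        Real.rpow_neg_one, mul_inv_cancel₀ hn.ne']
    have h2 : n * (4 * h n * (a n ^ 2 / b)) = 4 / b := by
      calc n * (4 * h n * (a n ^ 2 / b)) = n * (h n * a n ^ 2) * (4 / b) := by ring
        _ = 4 / b := by rw [h1, one_mul]
    rw [h2]
  have key := le_scaledMinimaxRisk hf₀ hφ ha.le hh hb hn3.le hfb s n
    (self_mem_localClass (M := M) (δ := c₀ * (n : ℝ) ^ (-r)) (ε := ε) hf₀ hd hM)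
    (add_bump_mem_localClass hs hf₀ hd hM hφ ha.le hh hn2.le hb hn3.le hfb hB hδ) hχ
  refine le_trans (le_of_eq ?_) key
  have hexp : (n : ℝ) ^ (2 * s / (2 * s + 1) : ℝ) * a n ^ 2 = (n : ℝ) ^ (β - q) := by
    rw [ha2, ← Real.rpow_add hn]
    congr 1; rw [hq]; field_simp; ring
  rw [← hexp]
  congr 1
  field_simp

end DensityLAM

theorem mainTheorem7 (S : Set ℝ) (hS : MeasurableSet S) (s : ℕ) (hs : 1 ≤ s)
    (x₀ : ℝ) (hx₀ : x₀ ∈ S) (f₀ : ℝ → ℝ) (hf₀ : DensityLAM.IsDensityOn S f₀)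
    (hsmooth : ContDiffAt ℝ s f₀ x₀)
    (M : ℝ) (hM : 0 < M) (c₀ : ℝ) (hc₀ : 0 < c₀)
    (r : ℝ) (hr0 : 0 ≤ r) (hr : r < 1 / (2 * s + 1)) (ε : ℝ) (hε : 0 < ε) :
    (⨆ (K : ℝ → ℝ) (_ : DensityLAM.IsKernel s K),
        ENNReal.ofReal (DensityLAM.lamConst s M K * f₀ x₀ ^ (2 * s / (2 * s + 1) : ℝ)
          * |iteratedDeriv s f₀ x₀| ^ (2 / (2 * s + 1) : ℝ)))
      ≤ liminf (fun n : ℕ => DensityLAM.scaledMinimaxRisk s n x₀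
          (DensityLAM.localClass S s f₀ x₀ M (c₀ * (n : ℝ) ^ (-r)) ε)) atTop := by
  rcases (hf₀.nonneg x₀).eq_or_lt with h0 | hpos
  -- The exponent of `f₀ x₀` must be nonzero, since `0 ^ 0 = 1`; this is where `s ≥ 1` enters.
  · refine iSup₂_le fun K _ => ?_
    have hne : (2 * s / (2 * s + 1) : ℝ) ≠ 0 := by positivity
    rw [← h0, Real.zero_rpow hne, mul_zero, zero_mul, ENNReal.ofReal_zero]
    exact zero_le
  · rw [(DensityLAM.tendsto_scaledMinimaxRisk_localClass hs hf₀ hsmooth hpos hM.le hc₀ hr0 hr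
      ε).liminf_eq]
    exact le_top
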